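/- Let $n,s\ge 1$ be integers, let $T_n$ be the Chebyshev polynomial of the first kind of degree $n$, and let $\xi_\nu=\cos\frac{(2\nu-1)\pi}{2n}$, $\nu=1,\dots,n$, be its zeros. For $0\le i\le 2s-1$ and $1\le\nu\le n$ let $\ell_{i,\nu}$ be the fundamental Hermite polynomial, i.e. the unique polynomial of degree less than $2sn$ with $\ell_{i,\nu}^{(j)}(\xi_\mu)=1$ if $(j,\mu)=(i,\nu)$ and $\ell_{i,\nu}^{(j)}(\xi_\mu)=0$ for all other pairs $(j,\mu)$ with $0\le j\le 2s-1$, $1\le\mu\le n$. Put $A_{i,\nu}=\int_{-1}^1 \ell_{i,\nu}(t)\,T_n(t)\,\frac{dt}{\sqrt{1-t^2}}$, and let $R_{n,s}(f)$ be the remainder of the quadrature formula $$\int_{-1}^1 f(t)\,T_n(t)\,\frac{dt}{\sqrt{1-t^2}}=\sum_{\nu=1}^n\sum_{i=0}^{2s-1}A_{i,\nu}f^{(i)}(\xi_\nu)+R_{n,s}(f).$$ Let $\rho>1$, let $\mathcal E_\rho=\{\frac12(u+u^{-1}) : u=\rho e^{i\theta},\ 0\le\theta\le 2\pi\}$ be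 the ellipse with foci $\pm1$ and sum of semi-axes $\rho$, and let $\mathcal D$ be the bounded open region enclosed by $\mathcal E_\rho$. If the function $f$ is analytic in $\mathcal D$ and continuous on $\overline{\mathcal D}$, then $$\left|R_{n,s}(f)\right|\le 2\pi\left(\max_{z\in\mathcal E_\rho}|f(z)|\right)\frac{\sum_{k=0}^s(-1)^k\binom{2s+1}{s-k}\rho^{2n(s-k)}}{\rho^n(\rho^{2n}-1)^{2s}}.$$ -/

import Mathlib

noncomputable section

namespace FourierChebyshev

open Polynomial

/-- A polynomial vanishing to order `m` at each of `n` distinct points and of degree `< n * m` is `0`. -/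
theorem hermite_eq_zero {n m : ℕ} {x : Fin n → ℝ} (hx : Function.Injective x) {p : ℝ[X]}
    (hdeg : p.degree < ((n * m : ℕ) : WithBot ℕ))
    (hp : ∀ (ν : Fin n) (i : Fin m), ((derivative^[(i : ℕ)]) p).eval (x ν) = 0) : p = 0 := by
  by_contra h0
  have hdvd : ∀ ν : Fin n, (X - C (x ν)) ^ m ∣ p := by
    intro ν
    rw [← Polynomial.le_rootMultiplicity_iff h0]
    rcases m with _ | k
    · simp
    · refine Polynomial.lt_rootMultiplicity_of_isRoot_iterate_derivative h0 ?_
      intro j hj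
      exact hp ν ⟨j, by omega⟩
  have hprod : (∏ ν : Fin n, (X - C (x ν)) ^ m) ∣ p := by
    refine Fintype.prod_dvd_of_coprime ?_ hdvd
    intro a b hab
    exact (Polynomial.pairwise_coprime_X_sub_C hx hab).pow
  have h1 := Polynomial.degree_le_of_dvd hprod h0
  have h2 : (∏ ν : Fin n, (X - C (x ν)) ^ m).degree = ((n * m : ℕ) : WithBot ℕ) := by
    rw [Polynomial.degree_prod]
    simp [Polynomial.degree_pow]
  rw [h2] at h1
  exact absurd hdeg (not_lt.mpr h1)

/-- Unique solvability of the Hermite interpolation problem at `n` distinct nodes,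
each of multiplicity `m`. -/
theorem existsUnique_hermite {n m : ℕ} {x : Fin n → ℝ} (hx : Function.Injective x)
    (c : Fin n → Fin m → ℝ) :
    ∃! p : ℝ[X], p.degree < ((n * m : ℕ) : WithBot ℕ) ∧
      ∀ (ν : Fin n) (i : Fin m), ((derivative^[(i : ℕ)]) p).eval (x ν) = c ν i := by
  let L : degreeLT ℝ (n * m) →ₗ[ℝ] (Fin n → Fin m → ℝ) :=
    { toFun := fun p ν i => ((derivative^[(i : ℕ)]) (p : ℝ[X])).eval (x ν)
      map_add' := by
        intro p q
        funext ν i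
        simp [iterate_map_add]
      map_smul' := by
        intro r p
        funext ν i
        simp [Polynomial.iterate_derivative_smul] }
  have hinj : Function.Injective L := by
    rw [injective_iff_map_eq_zero]
    intro p hp
    apply Subtype.ext
    refine hermite_eq_zero hx (mem_degreeLT.mp p.2) ?_
    intro ν i
    exact congrFun (congrFun hp ν) i
  have hsurj : Function.Surjective L := by
    have : FiniteDimensional ℝ (degreeLT ℝ (n * m)) :=
      Module.Finite.equiv (degreeLTEquiv ℝ (n * m)).symm
    refine (LinearMap.injective_iff_surjective_of_finrank_eq_finrank ?_).mp hinj
    rw [(degreeLTEquiv ℝ (n * m)).finrank_eq, Module.finrank_fin_fun,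
      Module.finrank_pi_fintype]
    simp
  obtain ⟨p, hp⟩ := hsurj c
  refine ⟨p, ⟨mem_degreeLT.mp p.2, fun ν i => congrFun (congrFun hp ν) i⟩, ?_⟩
  rintro q ⟨hq, hqc⟩
  have : L ⟨q, mem_degreeLT.mpr hq⟩ = L p := by
    rw [hp]
    funext ν i
    exact hqc ν i
  exact congrArg Subtype.val (hinj this)

/-- The zeros `ξ_ν = cos ((2ν - 1)π / (2n))`, `ν = 1, …, n`, of the Chebyshev polynomial `T_n`
(indexed here from `0`). -/
def chebyshevNode (n : ℕ) (ν : Fin n) : ℝ :=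
  Real.cos ((2 * ((ν : ℕ) : ℝ) + 1) * Real.pi / (2 * (n : ℝ)))

theorem chebyshevNode_injective (n : ℕ) : Function.Injective (chebyshevNode n) := by
  intro a b hab
  have hn : (0 : ℝ) < n := by
    have : 0 < n := lt_of_le_of_lt (Nat.zero_le _) a.2
    exact_mod_cast this
  have key : ∀ c : Fin n,
      (2 * ((c : ℕ) : ℝ) + 1) * Real.pi / (2 * (n : ℝ)) ∈ Set.Icc 0 Real.pi := by
    intro c
    have hc : ((c : ℕ) : ℝ) + 1 ≤ n := by exact_mod_cast c.2
    constructor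
    · positivity
    · rw [div_le_iff₀ (by positivity)]
      nlinarith [Real.pi_pos]
  have h := Real.injOn_cos (key a) (key b) hab
  have hpi := Real.pi_ne_zero
  have hn' := hn.ne'
  field_simp at h
  have : ((a : ℕ) : ℝ) = ((b : ℕ) : ℝ) := by linarith
  exact Fin.ext (by exact_mod_cast this)

theorem eval_T_chebyshevNode (n : ℕ) (ν : Fin n) :
    (Chebyshev.T ℝ n).eval (chebyshevNode n ν) = 0 := by
  have hn : (n : ℝ) ≠ 0 := by
    have : 0 < n := lt_of_le_of_lt (Nat.zero_le _) ν.2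
    exact_mod_cast this.ne'
  rw [chebyshevNode, Chebyshev.T_real_cos, Real.cos_eq_zero_iff]
  refine ⟨((ν : ℕ) : ℤ), ?_⟩
  push_cast
  field_simp

/-- The fundamental Hermite polynomial `ℓ_{i,ν}` for the nodes `ξ_1, …, ξ_n`, each of
multiplicity `2s`: the unique polynomial of degree `< 2sn` whose `j`-th derivative at `ξ_μ`
(`0 ≤ j ≤ 2s - 1`) is `1` if `(j, μ) = (i, ν)` and `0` otherwise. -/
def hermiteFundamental (n s : ℕ) (i : Fin (2 * s)) (ν : Fin n) : ℝ[X] :=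
  (existsUnique_hermite (m := 2 * s) (chebyshevNode_injective n)
    (fun μ j => if j = i ∧ μ = ν then 1 else 0)).choose

theorem hermiteFundamental_spec (n s : ℕ) (i : Fin (2 * s)) (ν : Fin n) :
    (hermiteFundamental n s i ν).degree < ((n * (2 * s) : ℕ) : WithBot ℕ) ∧
      ∀ (μ : Fin n) (j : Fin (2 * s)),
        ((derivative^[(j : ℕ)]) (hermiteFundamental n s i ν)).eval (chebyshevNode n μ)
          = if j = i ∧ μ = ν then 1 else 0 :=
  (existsUnique_hermite (m := 2 * s) (chebyshevNode_injective n)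
    (fun μ j => if j = i ∧ μ = ν then 1 else 0)).choose_spec.1

/-- The weight `A_{i,ν} = ∫_{-1}^1 ℓ_{i,ν}(t) T_n(t) dt / √(1 - t²)` of the quadrature formula. -/
def weight (n s : ℕ) (i : Fin (2 * s)) (ν : Fin n) : ℝ :=
  ∫ t in (-1 : ℝ)..1,
    (hermiteFundamental n s i ν).eval t * (Chebyshev.T ℝ n).eval t / Real.sqrt (1 - t ^ 2)

/-- The remainder `R_{n,s}(f)` of the quadrature formula
`∫_{-1}^1 f(t) T_n(t) dt / √(1 - t²) = ∑_ν ∑_{i=0}^{2s-1} A_{i,ν} f^{(i)}(ξ_ν) + R_{n,s}(f)`. -/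
def remainder (n s : ℕ) (f : ℂ → ℂ) : ℂ :=
  (∫ t in (-1 : ℝ)..1,
    f (t : ℂ) * (((Chebyshev.T ℝ n).eval t / Real.sqrt (1 - t ^ 2) : ℝ) : ℂ))
  - ∑ ν : Fin n, ∑ i : Fin (2 * s),
      ((weight n s i ν : ℝ) : ℂ) * iteratedDeriv (i : ℕ) f ((chebyshevNode n ν : ℝ) : ℂ)

/-- The ellipse `E_ρ = {(u + u⁻¹)/2 : u = ρ e^{iθ}, 0 ≤ θ ≤ 2π}`. -/
def ellipse (ρ : ℝ) : Set ℂ :=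
  {z | ∃ θ ∈ Set.Icc (0 : ℝ) (2 * Real.pi), ∃ u : ℂ,
    u = (ρ : ℂ) * Complex.exp ((θ : ℂ) * Complex.I) ∧ z = (1 / 2) * (u + u⁻¹)}

/-- The region bounded by `E_ρ`; the ellipse `E_ρ` has foci `±1` and sum of focal
distances `ρ + ρ⁻¹`. -/
def ellipseInterior (ρ : ℝ) : Set ℂ :=
  {z | ‖z - 1‖ + ‖z + 1‖ < ρ + ρ⁻¹}

end FourierChebyshev

end

namespace FourierChebyshev

open Polynomial MeasureTheory Filter Topology

/-! Let p be the Hermite interpolant of f. The quadrature sum is the integral of p against the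
weight, and f - p = T_n^(2s) g with g analytic in the ellipse, so t = cos θ gives R = ∫_0^π g
T_n^(2s+1) dθ. For t = (u + 1/u)/2 with |u| = 1, T_n = (u^n + u^(-n))/2; the binomial expansion of
T_n^(2s+1) splits into two halves exchanged by u ↦ 1/u. As g depends only on t, folding leaves one
half integrated over the whole circle (`remainder_eq_circleIntegral_one`).

For |u| > 1 that half is 2^(2s) K(u) T_n^(2s), with K = `remainderKernel`, so on a slightly larger
circle the integrand is K (f - p) du/u up to a constant. The p-part vanishes, since K p decays at
infinity; the f-part moves out to |u| = ρ (`remainder_eq_circleIntegral`). It remains to maximise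
|K| on |u| = ρ: rewriting the half binomial sum with positive coefficients in powers of x and 1 + x,
x = u^(2n), shows that x = -ρ^(2n) is extremal (`norm_halfBinomial_div_le`). -/

/-! ### Half binomial sums and their extremum on a circle -/

/-- The first half `∑_{j ≤ s} C(2s+1, j) x^j` of the binomial expansion of `(1 + x)^(2s+1)`. -/
def halfBinomial {K : Type*} [Field K] (s : ℕ) (x : K) : K :=
  ∑ j ∈ Finset.range (s + 1), (Nat.choose (2 * s + 1) j : K) * x ^ j

/-- The exponent 2s+1 is odd, so the expansion has no middle term and binomial symmetry carries its
upper half to the reversed lower half. -/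
theorem halfBinomial_add_reverse {K : Type*} [Field K] (s : ℕ) {x : K} (hx : x ≠ 0) :
    halfBinomial s x + x ^ (2 * s + 1) * halfBinomial s x⁻¹ = (1 + x) ^ (2 * s + 1) := by
  rw [add_comm 1 x, add_pow, show 2 * s + 1 + 1 = (s + 1) + (s + 1) by ring,
    Finset.sum_range_add]
  congr 1
  · exact Finset.sum_congr rfl fun j _ => by simp [mul_comm]
  · rw [halfBinomial, Finset.mul_sum, ← Finset.sum_range_reflect]
    refine Finset.sum_congr rfl fun j hj => ?_
    have hj' : j ≤ s := by simpa [Nat.lt_succ_iff] using hj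
    have h1 : s + 1 - 1 - j = s - j := by omega
    have h2 : 2 * s + 1 = (s + 1 + j) + (s - j) := by omega
    have h3 : (2 * s + 1).choose (s - j) = (2 * s + 1).choose (s + 1 + j) :=
      Nat.choose_symm_of_eq_add (by omega)
    rw [h1, h3, h2, pow_add, inv_pow]
    field_simp
    simp

/-- Pascal's rule: as m grows by one, both sides get multiplied by 1 + x and gain the same top term.
Keeping b free of m makes the induction close; the case needed is b = m = s. -/
theorem sum_choose_mul_pow_eq {K : Type*} [Field K] (b m : ℕ) (x : K) :
    ∑ j ∈ Finset.range (m + 1), (Nat.choose (m + b + 1) j : K) * x ^ j =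
      ∑ j ∈ Finset.range (m + 1), (Nat.choose (b + j) j : K) * x ^ j * (1 + x) ^ (m - j) := by
  induction m with
  | zero => simp
  | succ m ih =>
    have hA : ∑ j ∈ Finset.range (m + 1 + 1), (Nat.choose (m + 1 + b + 1) j : K) * x ^ j =
        (1 + x) * ∑ j ∈ Finset.range (m + 1), (Nat.choose (m + b + 1) j : K) * x ^ j +
          (Nat.choose (m + b + 1) (m + 1) : K) * x ^ (m + 1) := by
      have h1 := Finset.sum_range_succ (fun j => (Nat.choose (m + b + 1) j : K) * x ^ j) (m + 1)
      rw [Finset.sum_range_succ'] at h1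
      have h2 : ∑ j ∈ Finset.range (m + 1), (Nat.choose (m + 1 + b + 1) (j + 1) : K) * x ^ (j + 1) =
          ∑ j ∈ Finset.range (m + 1), (Nat.choose (m + b + 1) (j + 1) : K) * x ^ (j + 1) +
            x * ∑ j ∈ Finset.range (m + 1), (Nat.choose (m + b + 1) j : K) * x ^ j := by
        rw [Finset.mul_sum, ← Finset.sum_add_distrib]
        refine Finset.sum_congr rfl fun j _ => ?_
        rw [show m + 1 + b + 1 = (m + b + 1) + 1 by ring, Nat.choose_succ_succ]
        push_cast
        ring
      rw [Finset.sum_range_succ', h2]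
      simp only [Nat.choose_zero_right] at h1 ⊢
      linear_combination h1
    rw [hA, ih, Finset.sum_range_succ _ (m + 1), Finset.mul_sum]
    congr 1
    · refine Finset.sum_congr rfl fun j hj => ?_
      have hj' : j ≤ m := by simpa [Nat.lt_succ_iff] using hj
      rw [show m + 1 - j = (m - j) + 1 by omega, pow_succ]
      ring
    · rw [show b + (m + 1) = m + b + 1 by ring]
      simp

theorem halfBinomial_eq_sum {K : Type*} [Field K] (s : ℕ) (x : K) :
    halfBinomial s x =
      ∑ j ∈ Finset.range (s + 1), (Nat.choose (s + j) j : K) * x ^ j * (1 + x) ^ (s - j) := by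
  rw [← sum_choose_mul_pow_eq, halfBinomial, two_mul]

theorem sum_alternating_eq_halfBinomial_neg (s : ℕ) (q : ℝ) :
    ∑ k ∈ Finset.range (s + 1), (-1 : ℝ) ^ k * (Nat.choose (2 * s + 1) (s - k) : ℝ) * q ^ (s - k) =
      (-1) ^ s * halfBinomial s (-q) := by
  rw [halfBinomial, Finset.mul_sum, ← Finset.sum_range_reflect]
  refine Finset.sum_congr rfl fun j hj => ?_
  have hj' : j ≤ s := by simpa [Nat.lt_succ_iff] using hj
  rw [show s + 1 - 1 - j = s - j by omega, show s - (s - j) = j by omega]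
  obtain ⟨k, rfl⟩ := Nat.exists_eq_add_of_le hj'
  rw [show j + k - j = k by omega, neg_pow q j, pow_add (-1 : ℝ) j k]
  have : (-1 : ℝ) ^ j * (-1) ^ j = 1 := by rw [← mul_pow]; simp
  linear_combination (-(-1) ^ k * ((2 * (j + k) + 1).choose j : ℝ) * q ^ j) * this

/-- On the circle `‖x‖ = q`, the quotient `‖halfBinomial s x‖ / ‖1 + x‖ ^ (2 s)` is largest
at `x = -q`. -/
theorem norm_halfBinomial_div_le (s : ℕ) {q : ℝ} (hq : 1 < q) {x : ℂ} (hx : ‖x‖ = q) :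
    ‖halfBinomial s x / (1 + x) ^ (2 * s)‖ ≤
      (∑ k ∈ Finset.range (s + 1),
        (-1 : ℝ) ^ k * (Nat.choose (2 * s + 1) (s - k) : ℝ) * q ^ (s - k)) / (q - 1) ^ (2 * s) := by
  have hq0 : 0 < q - 1 := by linarith
  have hle : q - 1 ≤ ‖1 + x‖ := by
    have := norm_sub_norm_le x (-1)
    rw [norm_neg, norm_one, hx, sub_neg_eq_add, add_comm x] at this
    exact this
  have hx1 : 1 + x ≠ 0 := norm_pos_iff.mp (hq0.trans_le hle)
  -- Stated over any field because it serves both at the complex x and at the real point -q.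
  have key : ∀ {K : Type} [Field K] (y : K), 1 + y ≠ 0 →
      halfBinomial s y / (1 + y) ^ (2 * s) =
        ∑ j ∈ Finset.range (s + 1), (Nat.choose (s + j) j : K) * y ^ j / (1 + y) ^ (s + j) := by
    intro K _ y hy
    rw [halfBinomial_eq_sum, Finset.sum_div]
    refine Finset.sum_congr rfl fun j hj => ?_
    have hj' : j ≤ s := by simpa [Nat.lt_succ_iff] using hj
    rw [show 2 * s = (s - j) + (s + j) by omega, pow_add]
    field_simp
  rw [sum_alternating_eq_halfBinomial_neg, key x hx1]
  have h1 : (1 : ℝ) + -q ≠ 0 := by linarith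
  have h2 : (q - 1) ^ (2 * s) = (1 + -q) ^ (2 * s) := by
    rw [pow_mul, pow_mul]; ring
  rw [h2, mul_div_assoc, key (-q) h1, Finset.mul_sum]
  refine (norm_sum_le _ _).trans (Finset.sum_le_sum fun j _ => ?_)
  -- At -q the signs (-1)^s, (-1)^j and (-1)^(s+j) cancel, so every term is positive there and the
  -- termwise triangle inequality loses nothing.
  have h3 : (-1 : ℝ) ^ s * (((s + j).choose j : ℝ) * (-q) ^ j / (1 + -q) ^ (s + j)) =
      ((s + j).choose j : ℝ) * q ^ j / (q - 1) ^ (s + j) := by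
    rw [show (1 : ℝ) + -q = -(q - 1) by ring, neg_pow q, neg_pow (q - 1), pow_add (-1 : ℝ)]
    have e1 : (-1 : ℝ) ^ s ≠ 0 := pow_ne_zero _ (by norm_num)
    have e2 : (-1 : ℝ) ^ j ≠ 0 := pow_ne_zero _ (by norm_num)
    field_simp
  rw [h3, norm_div, norm_mul, norm_pow, norm_pow, hx, Complex.norm_natCast]
  gcongr

/-! ### The Joukowski map and the ellipse -/

/-- The Joukowski map `u ↦ (u + u⁻¹) / 2`. -/
noncomputable def joukowski (u : ℂ) : ℂ := (1 / 2) * (u + u⁻¹)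

/-- With u = e^w this is T_n(cosh w) = cosh(nw). -/
theorem eval_T_joukowski (n : ℕ) {u : ℂ} (hu : u ≠ 0) :
    (Chebyshev.T ℂ n).eval (joukowski u) = (1 + u ^ (2 * n)) / (2 * u ^ n) := by
  have h : joukowski u = Complex.cosh (Complex.log u) := by
    rw [joukowski, Complex.cosh, Complex.exp_neg, Complex.exp_log hu]
    ring
  rw [h, Chebyshev.T_complex_cosh, Complex.cosh, Complex.exp_neg]
  push_cast
  rw [Complex.exp_nat_mul, Complex.exp_log hu, two_mul n, pow_add]
  have := pow_ne_zero n hu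
  field_simp
  ring

/-- J(u) ∓ 1 = (u ∓ 1)²/(2u), and the parallelogram law adds the two moduli. Circles therefore go to
ellipses with foci ±1. -/
theorem norm_joukowski_sub_add (u : ℂ) (hu : u ≠ 0) :
    ‖joukowski u - 1‖ + ‖joukowski u + 1‖ = ‖u‖ + ‖u‖⁻¹ := by
  have hu' : ‖u‖ ≠ 0 := norm_ne_zero_iff.mpr hu
  have h1 : joukowski u - 1 = (u - 1) ^ 2 / (2 * u) := by
    rw [joukowski]; field_simp; ring
  have h2 : joukowski u + 1 = (u + 1) ^ 2 / (2 * u) := by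
    rw [joukowski]; field_simp; ring
  have h3 := parallelogram_law_with_norm ℝ u 1
  rw [norm_one] at h3
  rw [h1, h2, norm_div, norm_div, norm_pow, norm_pow, norm_mul, Complex.norm_ofNat]
  field_simp
  linarith

theorem joukowski_mem_ellipseInterior {ρ : ℝ} {u : ℂ} (h1 : 1 ≤ ‖u‖) (h2 : ‖u‖ < ρ) :
    joukowski u ∈ ellipseInterior ρ := by
  have hu : u ≠ 0 := norm_pos_iff.mp (by linarith)
  rw [ellipseInterior, Set.mem_ofPred_eq, norm_joukowski_sub_add u hu]
  have h3 : 0 < ‖u‖ := by linarith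
  have h4 : 0 < ρ := by linarith
  have : ρ + ρ⁻¹ - (‖u‖ + ‖u‖⁻¹) = (ρ - ‖u‖) * (ρ * ‖u‖ - 1) / (ρ * ‖u‖) := by
    field_simp
    ring
  have h5 : 0 < (ρ - ‖u‖) * (ρ * ‖u‖ - 1) / (ρ * ‖u‖) := by
    have : 0 < ρ * ‖u‖ - 1 := by nlinarith
    have : 0 < ρ - ‖u‖ := by linarith
    positivity
  linarith

theorem continuousAt_joukowski {u : ℂ} (hu : u ≠ 0) : ContinuousAt joukowski u := by
  unfold joukowski
  fun_prop (disch := assumption)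

theorem differentiableAt_joukowski {u : ℂ} (hu : u ≠ 0) : DifferentiableAt ℂ joukowski u := by
  unfold joukowski
  fun_prop (disch := assumption)

theorem joukowski_mem_closure {ρ : ℝ} (hρ : 1 < ρ) {u : ℂ} (h1 : 1 ≤ ‖u‖) (h2 : ‖u‖ ≤ ρ) :
    joukowski u ∈ closure (ellipseInterior ρ) := by
  rcases h2.lt_or_eq with h2 | h2
  · exact subset_closure (joukowski_mem_ellipseInterior h1 h2)
  have hu : u ≠ 0 := norm_pos_iff.mp (by linarith)
  -- A boundary point is approached along tu as t increases to 1; taking t > 1/ρ keeps |tu| > 1.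
  have ht : Filter.Tendsto (fun t : ℝ => joukowski ((t : ℂ) * u)) (nhdsWithin 1 (Set.Iio 1))
      (nhds (joukowski u)) := by
    have hc : Filter.Tendsto (fun t : ℝ => (t : ℂ) * u) (nhdsWithin 1 (Set.Iio 1)) (nhds u) := by
      have : Continuous fun t : ℝ => (t : ℂ) * u := by fun_prop
      simpa using (this.tendsto 1).mono_left nhdsWithin_le_nhds
    exact (continuousAt_joukowski hu).tendsto.comp hc
  refine mem_closure_of_tendsto ht ?_
  have hρ' : ρ⁻¹ < 1 := inv_lt_one_of_one_lt₀ hρ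
  have h0 : 0 < ρ := by linarith
  filter_upwards [Ioo_mem_nhdsLT hρ'] with t ht
  have ht0 : 0 < t := (inv_pos.mpr h0).trans ht.1
  have hn : ‖(t : ℂ) * u‖ = t * ρ := by
    rw [norm_mul, Complex.norm_real, h2, Real.norm_of_nonneg ht0.le]
  apply joukowski_mem_ellipseInterior
  · rw [hn]
    have := mul_lt_mul_of_pos_right ht.1 h0
    rw [inv_mul_cancel₀ h0.ne'] at this
    exact this.le
  · rw [hn]
    nlinarith [ht.2]

theorem isOpen_ellipseInterior (ρ : ℝ) : IsOpen (ellipseInterior ρ) :=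
  isOpen_lt (by fun_prop) continuous_const

theorem ofReal_mem_ellipseInterior {ρ : ℝ} (hρ : 1 < ρ) {t : ℝ} (ht : t ∈ Set.Icc (-1 : ℝ) 1) :
    (t : ℂ) ∈ ellipseInterior ρ := by
  have h0 : 0 < ρ := by linarith
  have h1 : ‖(t : ℂ) - 1‖ = 1 - t := by
    rw [← Complex.ofReal_one, ← Complex.ofReal_sub, Complex.norm_real, Real.norm_eq_abs,
      abs_of_nonpos (by linarith [ht.2])]
    ring
  have h2 : ‖(t : ℂ) + 1‖ = t + 1 := by
    rw [← Complex.ofReal_one, ← Complex.ofReal_add, Complex.norm_real, Real.norm_eq_abs,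
      abs_of_nonneg (by linarith [ht.1])]
  rw [ellipseInterior, Set.mem_ofPred_eq, h1, h2]
  have : ρ + ρ⁻¹ - 2 = (ρ - 1) ^ 2 / ρ := by field_simp; ring
  have : 0 < (ρ - 1) ^ 2 / ρ := by
    have : 0 < ρ - 1 := by linarith
    positivity
  linarith

theorem chebyshevNode_mem_Icc (n : ℕ) (ν : Fin n) : chebyshevNode n ν ∈ Set.Icc (-1 : ℝ) 1 :=
  Real.cos_mem_Icc _

theorem joukowski_exp (θ : ℂ) : joukowski (Complex.exp (θ * Complex.I)) = Complex.cos θ := by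
  rw [joukowski, Complex.cos, ← Complex.exp_neg, neg_mul]
  ring

theorem ellipse_eq_image (ρ : ℝ) :
    ellipse ρ = (fun θ : ℝ => joukowski ((ρ : ℂ) * Complex.exp ((θ : ℂ) * Complex.I))) ''
      Set.Icc 0 (2 * Real.pi) := by
  ext z
  constructor
  · rintro ⟨θ, hθ, u, rfl, rfl⟩
    exact ⟨θ, hθ, rfl⟩
  · rintro ⟨θ, hθ, rfl⟩
    exact ⟨θ, hθ, _, rfl, rfl⟩

theorem norm_ofReal_mul_exp {ρ : ℝ} (hρ : 0 < ρ) (θ : ℝ) :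
    ‖(ρ : ℂ) * Complex.exp ((θ : ℂ) * Complex.I)‖ = ρ := by
  rw [norm_mul, Complex.norm_exp_ofReal_mul_I, mul_one, Complex.norm_real,
    Real.norm_of_nonneg hρ.le]

theorem isCompact_ellipse {ρ : ℝ} (hρ : 0 < ρ) : IsCompact (ellipse ρ) := by
  rw [ellipse_eq_image]
  refine isCompact_Icc.image (continuous_iff_continuousAt.mpr fun θ => ?_)
  have h0 : (ρ : ℂ) * Complex.exp ((θ : ℂ) * Complex.I) ≠ 0 :=
    norm_pos_iff.mp (by rwa [norm_ofReal_mul_exp hρ])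
  exact ContinuousAt.comp (f := fun θ : ℝ => (ρ : ℂ) * Complex.exp ((θ : ℂ) * Complex.I))
    (continuousAt_joukowski h0) (by fun_prop)

theorem ellipse_nonempty (ρ : ℝ) : (ellipse ρ).Nonempty := by
  rw [ellipse_eq_image]
  exact (Set.nonempty_Icc.mpr (by positivity)).image _

theorem ellipse_subset_closure {ρ : ℝ} (hρ : 1 < ρ) :
    ellipse ρ ⊆ closure (ellipseInterior ρ) := by
  rw [ellipse_eq_image]
  rintro _ ⟨θ, _, rfl⟩
  have h := norm_ofReal_mul_exp (zero_lt_one.trans hρ) θ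
  exact joukowski_mem_closure hρ (by rw [h]; exact hρ.le) h.le

theorem joukowski_mem_ellipse {ρ : ℝ} {u : ℂ} (hu : ‖u‖ = ρ) : joukowski u ∈ ellipse ρ := by
  rw [ellipse_eq_image]
  -- `Complex.arg` lies in (-π, π], so it is reduced modulo 2π to fit the parametrisation of the
  -- ellipse.
  refine ⟨toIcoMod Real.two_pi_pos 0 u.arg, ?_, ?_⟩
  · have := toIcoMod_mem_Ico Real.two_pi_pos 0 u.arg
    rw [zero_add] at this
    exact Set.Ico_subset_Icc_self this
  · have h1 := Complex.norm_mul_exp_arg_mul_I u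
    have h2 : Complex.exp ((toIcoMod Real.two_pi_pos 0 u.arg : ℝ) * Complex.I) =
        Complex.exp (u.arg * Complex.I) := by
      rw [toIcoMod, Complex.exp_eq_exp_iff_exists_int]
      refine ⟨-toIcoDiv Real.two_pi_pos 0 u.arg, ?_⟩
      push_cast [zsmul_eq_mul]
      ring
    dsimp only
    rw [h2, ← hu, h1]

/-! ### Dividing out prescribed zeros -/

theorem exists_eq_pow_mul_of_le_analyticOrderAt {U : Set ℂ} {f : ℂ → ℂ}
    (hf : AnalyticOnNhd ℂ f U) {a : ℂ} {m : ℕ} (ha : a ∈ U) (hm : (m : ℕ∞) ≤ analyticOrderAt f a) :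
    ∃ g : ℂ → ℂ, AnalyticOnNhd ℂ g U ∧ ∀ z ∈ U, f z = (z - a) ^ m * g z := by
  classical
  obtain ⟨g₀, hg₀, hfg⟩ := (natCast_le_analyticOrderAt (hf a ha)).mp hm
  -- The quotient away from a, with the removable singularity filled by the local factor `g₀`.
  refine ⟨fun z => if z = a then g₀ a else f z / (z - a) ^ m, fun z hz => ?_, fun z _ => ?_⟩
  · rcases eq_or_ne z a with rfl | hza
    · refine hg₀.congr ?_
      filter_upwards [hfg] with w hw
      rcases eq_or_ne w z with rfl | hwz
      · simp
      · rw [if_neg hwz, hw, smul_eq_mul,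
          mul_div_cancel_left₀ _ (pow_ne_zero _ (sub_ne_zero.mpr hwz))]
    · have h : AnalyticAt ℂ (fun w => f w / (w - a) ^ m) z :=
        (hf z hz).div (by fun_prop) (pow_ne_zero _ (sub_ne_zero.mpr hza))
      refine h.congr ?_
      filter_upwards [isOpen_ne.mem_nhds hza] with w hw
      rw [if_neg hw]
  · rcases eq_or_ne z a with rfl | hza
    · simpa using hfg.self_of_nhds
    · dsimp only
      rw [if_neg hza, mul_div_cancel₀ _ (pow_ne_zero _ (sub_ne_zero.mpr hza))]

/-- An analytic function vanishing to order `m` at the points of a finite set is divisible by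
`∏ (z - a) ^ m`. -/
theorem exists_eq_prod_mul_of_le_analyticOrderAt {U : Set ℂ} (hU : IsOpen U) {f : ℂ → ℂ}
    (hf : AnalyticOnNhd ℂ f U) {m : ℕ} (S : Finset ℂ) (hS : ∀ a ∈ S, a ∈ U)
    (hm : ∀ a ∈ S, (m : ℕ∞) ≤ analyticOrderAt f a) :
    ∃ g : ℂ → ℂ, AnalyticOnNhd ℂ g U ∧ ∀ z ∈ U, f z = (∏ a ∈ S, (z - a) ^ m) * g z := by
  classical
  induction S using Finset.induction_on with
  | empty => exact ⟨f, hf, by simp⟩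
  | insert a S haS ih =>
    obtain ⟨g, hg, hfg⟩ := ih (fun b hb => hS b (Finset.mem_insert_of_mem hb))
      (fun b hb => hm b (Finset.mem_insert_of_mem hb))
    have haU := hS a (Finset.mem_insert_self a S)
    have hP : AnalyticAt ℂ (fun z : ℂ => ∏ b ∈ S, (z - b) ^ m) a := by fun_prop
    have hP0 : analyticOrderAt (fun z : ℂ => ∏ b ∈ S, (z - b) ^ m) a = 0 := by
      rw [hP.analyticOrderAt_eq_zero, Finset.prod_ne_zero_iff]
      exact fun b hb => pow_ne_zero _ (sub_ne_zero.mpr fun h => haS (h ▸ hb))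
    -- The factors already removed do not vanish at a, so g keeps the full order of f there.
    have hord : analyticOrderAt f a = analyticOrderAt g a := by
      have h1 : f =ᶠ[nhds a] (fun z : ℂ => ∏ b ∈ S, (z - b) ^ m) * g := by
        filter_upwards [hU.mem_nhds haU] with z hz using hfg z hz
      rw [analyticOrderAt_congr h1, analyticOrderAt_mul hP (hg a haU), hP0, zero_add]
    obtain ⟨k, hk, hgk⟩ := exists_eq_pow_mul_of_le_analyticOrderAt hg haU
      (hord ▸ hm a (Finset.mem_insert_self a S))
    refine ⟨k, hk, fun z hz => ?_⟩
    rw [hfg z hz, hgk z hz, Finset.prod_insert haS]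
    ring

/-! ### Hermite interpolation at the Chebyshev nodes -/

theorem iteratedDeriv_polynomial_eval (p : ℂ[X]) (j : ℕ) :
    iteratedDeriv j (fun z => p.eval z) = fun z => ((derivative^[j]) p).eval z := by
  induction j with
  | zero => simp
  | succ j ih =>
    rw [iteratedDeriv_succ, ih, Function.iterate_succ_apply']
    funext z
    exact Polynomial.deriv _

/-- The Hermite interpolation polynomial of `f` at the Chebyshev nodes, each of
multiplicity `2 s`. -/
noncomputable def hermiteInterpolant (n s : ℕ) (f : ℂ → ℂ) : ℂ[X] :=
  ∑ ν : Fin n, ∑ i : Fin (2 * s),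
    C (iteratedDeriv (i : ℕ) f ((chebyshevNode n ν : ℝ) : ℂ)) *
      (hermiteFundamental n s i ν).map (algebraMap ℝ ℂ)

theorem degree_hermiteInterpolant_lt (n s : ℕ) (f : ℂ → ℂ) :
    (hermiteInterpolant n s f).degree < ((n * (2 * s) : ℕ) : WithBot ℕ) := by
  rw [← mem_degreeLT, hermiteInterpolant]
  refine Submodule.sum_mem _ fun ν _ => Submodule.sum_mem _ fun i _ => ?_
  rw [C_mul']
  refine Submodule.smul_mem _ _ ?_
  rw [mem_degreeLT, degree_map]
  exact (hermiteFundamental_spec n s i ν).1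

theorem eval_iterate_derivative_hermiteInterpolant (n s : ℕ) (f : ℂ → ℂ) (μ : Fin n)
    (j : Fin (2 * s)) :
    ((derivative^[(j : ℕ)]) (hermiteInterpolant n s f)).eval ((chebyshevNode n μ : ℝ) : ℂ) =
      iteratedDeriv (j : ℕ) f ((chebyshevNode n μ : ℝ) : ℂ) := by
  have h : ∀ (ν : Fin n) (i : Fin (2 * s)),
      ((derivative^[(j : ℕ)]) (C (iteratedDeriv (i : ℕ) f ((chebyshevNode n ν : ℝ) : ℂ)) *
        (hermiteFundamental n s i ν).map (algebraMap ℝ ℂ))).eval ((chebyshevNode n μ : ℝ) : ℂ) =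
      if ν = μ then (if i = j then iteratedDeriv (i : ℕ) f ((chebyshevNode n ν : ℝ) : ℂ) else 0)
        else 0 := by
    intro ν i
    rw [iterate_derivative_C_mul, eval_C_mul, iterate_derivative_map,
      ← Complex.coe_algebraMap, eval_map_algebraMap, aeval_algebraMap_apply,
      coe_aeval_eq_eval, (hermiteFundamental_spec n s i ν).2 μ j]
    split_ifs <;> simp_all
  simp only [hermiteInterpolant, iterate_derivative_sum, eval_finsetSum, h]
  rw [Finset.sum_comm]
  simp

/-- The n distinct nodes are roots and the degree is n, so there are no others. -/
theorem T_eq_C_mul_prod {n : ℕ} :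
    Chebyshev.T ℝ n = C (Chebyshev.T ℝ n).leadingCoeff * ∏ ν : Fin n, (X - C (chebyshevNode n ν)) := by
  have hmonic : (∏ ν : Fin n, (X - C (chebyshevNode n ν))).Monic :=
    monic_prod_of_monic _ _ fun ν _ => monic_X_sub_C _
  have hdvd : (∏ ν : Fin n, (X - C (chebyshevNode n ν))) ∣ Chebyshev.T ℝ n :=
    Fintype.prod_dvd_of_coprime
      (fun a b hab => pairwise_coprime_X_sub_C (chebyshevNode_injective n) hab)
      fun ν => dvd_iff_isRoot.mpr (eval_T_chebyshevNode n ν)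
  refine eq_leadingCoeff_mul_of_monic_of_dvd_of_natDegree_le hmonic hdvd ?_
  rw [Chebyshev.natDegree_T, natDegree_prod_of_monic _ _ fun ν _ => monic_X_sub_C _]
  simp

/-- f - p vanishes to order 2s at every node, and the product of these factors is T_n^(2s) up to a
power of the leading coefficient, which g absorbs. -/
theorem exists_sub_hermiteInterpolant_eq {n s : ℕ} {ρ : ℝ} (hρ : 1 < ρ) {f : ℂ → ℂ}
    (hf : AnalyticOnNhd ℂ f (ellipseInterior ρ)) :
    ∃ g : ℂ → ℂ, AnalyticOnNhd ℂ g (ellipseInterior ρ) ∧ ∀ z ∈ ellipseInterior ρ,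
      f z - (hermiteInterpolant n s f).eval z = ((Chebyshev.T ℂ n).eval z) ^ (2 * s) * g z := by
  classical
  set p := hermiteInterpolant n s f with hp
  have hpa : ∀ z : ℂ, AnalyticAt ℂ (fun z => p.eval z) z := fun z => by
    simpa using AnalyticAt.aeval_polynomial (analyticAt_id (𝕜 := ℂ) (z := z)) p
  have hinj : Function.Injective fun ν : Fin n => ((chebyshevNode n ν : ℝ) : ℂ) :=
    Complex.ofReal_injective.comp (chebyshevNode_injective n)
  have hnode : ∀ ν : Fin n, ((chebyshevNode n ν : ℝ) : ℂ) ∈ ellipseInterior ρ := fun ν =>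
    ofReal_mem_ellipseInterior hρ (chebyshevNode_mem_Icc n ν)
  have hfp : AnalyticOnNhd ℂ (fun z => f z - p.eval z) (ellipseInterior ρ) :=
    fun z hz => (hf z hz).sub (hpa z)
  obtain ⟨g, hg, hgf⟩ := exists_eq_prod_mul_of_le_analyticOrderAt (m := 2 * s)
    (isOpen_ellipseInterior ρ) hfp
    (Finset.univ.image fun ν : Fin n => ((chebyshevNode n ν : ℝ) : ℂ)) (by simpa using hnode) (by
      intro a ha
      obtain ⟨ν, -, rfl⟩ := Finset.mem_image.mp ha
      rw [natCast_le_analyticOrderAt_iff_iteratedDeriv_eq_zero (hfp _ (hnode ν))]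
      intro i hi
      rw [iteratedDeriv_fun_sub (hf _ (hnode ν)).contDiffAt (hpa _).contDiffAt,
        iteratedDeriv_polynomial_eval, sub_eq_zero]
      exact (eval_iterate_derivative_hermiteInterpolant n s f ν ⟨i, hi⟩).symm)
  have hlc : ((Chebyshev.T ℝ n).leadingCoeff : ℂ) ≠ 0 := by
    rw [Chebyshev.leadingCoeff_T]
    simp
  have hT : ∀ z : ℂ, (Chebyshev.T ℂ n).eval z =
      ((Chebyshev.T ℝ n).leadingCoeff : ℂ) * ∏ ν : Fin n, (z - ((chebyshevNode n ν : ℝ) : ℂ)) := by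
    intro z
    have h := congrArg (fun q => (q.map (algebraMap ℝ ℂ)).eval z) (T_eq_C_mul_prod (n := n))
    simpa [Polynomial.map_prod, eval_prod] using h
  refine ⟨fun z => (((Chebyshev.T ℝ n).leadingCoeff : ℂ) ^ (2 * s))⁻¹ * g z,
    fun z hz => analyticAt_const.mul (hg z hz), fun z hz => ?_⟩
  rw [hgf z hz, Finset.prod_image fun a _ b _ h => hinj h, hT, mul_pow, Finset.prod_pow]
  have := pow_ne_zero (2 * s) hlc
  field_simp

/-! ### The remainder as a trigonometric integral -/

theorem integral_mul_inv_sqrt_eq_integral_cos (φ : ℝ → ℂ) :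
    ∫ t in (-1 : ℝ)..1, φ t * (((√(1 - t ^ 2))⁻¹ : ℝ) : ℂ) =
      ∫ θ in (0 : ℝ)..Real.pi, φ (Real.cos θ) := by
  -- Substituting θ = arccos t, which is monotone, requires derivatives only on the open interval,
  -- so the endpoint singularities of the weight do no harm.
  have h := intervalIntegral.integral_deriv_smul_comp_of_deriv_nonpos (a := -1) (b := 1)
    (f := Real.arccos) (f' := fun x => -(1 / √(1 - x ^ 2))) (g := fun θ => φ (Real.cos θ))
    (by fun_prop)
    (fun x hx => Real.hasDerivAt_arccos (by aesop) (by aesop)) (fun x _ => by simp)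
  rw [Real.arccos_neg_one, Real.arccos_one, intervalIntegral.integral_symm 0 Real.pi] at h
  rw [← neg_neg (∫ θ in (0 : ℝ)..Real.pi, φ (Real.cos θ)), ← h, ← intervalIntegral.integral_neg]
  refine intervalIntegral.integral_congr fun x hx => ?_
  rw [Set.uIcc_of_le (by norm_num)] at hx
  simp [Real.cos_arccos hx.1 hx.2, mul_comm]

theorem intervalIntegrable_mul_T_div_sqrt (n : ℕ) {φ : ℝ → ℂ}
    (hφ : ContinuousOn φ (Set.Icc (-1) 1)) :
    IntervalIntegrable
      (fun t => φ t * (((Chebyshev.T ℝ n).eval t / √(1 - t ^ 2) : ℝ) : ℂ)) volume (-1) 1 := by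
  have h1 : IntervalIntegrable (fun t : ℝ => (((√(1 - t ^ 2))⁻¹ : ℝ) : ℂ)) volume (-1) 1 := by
    have h := Chebyshev.intervalIntegrable_sqrt_one_sub_sq_inv
    simp only [Real.sqrt_inv] at h
    exact ⟨h.1.ofReal, h.2.ofReal⟩
  have h2 : ContinuousOn (fun t => φ t * (((Chebyshev.T ℝ n).eval t : ℝ) : ℂ))
      (Set.uIcc (-1) 1) := by
    rw [Set.uIcc_of_le (by norm_num)]
    exact hφ.mul (by fun_prop)
  refine (h1.continuousOn_mul h2).congr (fun t _ => ?_)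
  push_cast
  ring

/-- By linearity, the quadrature formula is interpolatory: it integrates the Hermite interpolant in
place of f. -/
theorem sum_weight_mul_iteratedDeriv (n s : ℕ) (f : ℂ → ℂ) :
    ∑ ν : Fin n, ∑ i : Fin (2 * s),
      ((weight n s i ν : ℝ) : ℂ) * iteratedDeriv (i : ℕ) f ((chebyshevNode n ν : ℝ) : ℂ) =
    ∫ t in (-1 : ℝ)..1, (hermiteInterpolant n s f).eval (t : ℂ) *
      (((Chebyshev.T ℝ n).eval t / √(1 - t ^ 2) : ℝ) : ℂ) := by
  have hint : ∀ (ν : Fin n) (i : Fin (2 * s)), IntervalIntegrable (fun t : ℝ =>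
      (iteratedDeriv (i : ℕ) f ((chebyshevNode n ν : ℝ) : ℂ) *
        (((hermiteFundamental n s i ν).eval t : ℝ) : ℂ)) *
      (((Chebyshev.T ℝ n).eval t / √(1 - t ^ 2) : ℝ) : ℂ)) volume (-1) 1 := fun ν i =>
    intervalIntegrable_mul_T_div_sqrt n (by fun_prop)
  have hsum : ∀ ν : Fin n, IntervalIntegrable (fun t : ℝ => ∑ i : Fin (2 * s),
      (iteratedDeriv (i : ℕ) f ((chebyshevNode n ν : ℝ) : ℂ) *
        (((hermiteFundamental n s i ν).eval t : ℝ) : ℂ)) *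
      (((Chebyshev.T ℝ n).eval t / √(1 - t ^ 2) : ℝ) : ℂ)) volume (-1) 1 := fun ν => by
    simpa only [Finset.sum_fn] using IntervalIntegrable.sum Finset.univ fun i _ => hint ν i
  have heval : ∀ t : ℝ, (hermiteInterpolant n s f).eval (t : ℂ) *
      (((Chebyshev.T ℝ n).eval t / √(1 - t ^ 2) : ℝ) : ℂ) =
      ∑ ν : Fin n, ∑ i : Fin (2 * s),
      (iteratedDeriv (i : ℕ) f ((chebyshevNode n ν : ℝ) : ℂ) *
        (((hermiteFundamental n s i ν).eval t : ℝ) : ℂ)) *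
      (((Chebyshev.T ℝ n).eval t / √(1 - t ^ 2) : ℝ) : ℂ) := by
    intro t
    simp only [hermiteInterpolant, eval_finsetSum, Finset.sum_mul, eval_C_mul,
      ← Complex.coe_algebraMap, eval_map_algebraMap, aeval_algebraMap_apply, coe_aeval_eq_eval]
  simp only [heval]
  rw [intervalIntegral.integral_finsetSum fun ν _ => hsum ν]
  refine Finset.sum_congr rfl fun ν _ => ?_
  rw [intervalIntegral.integral_finsetSum fun i _ => hint ν i]
  refine Finset.sum_congr rfl fun i _ => ?_
  simp only [mul_assoc]
  rw [intervalIntegral.integral_const_mul, weight, ← intervalIntegral.integral_ofReal, mul_comm]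
  simp only [mul_div_assoc, Complex.ofReal_mul]

theorem remainder_eq_integral_cos (n s : ℕ) {f : ℂ → ℂ}
    (hf : ContinuousOn (fun t : ℝ => f t) (Set.Icc (-1) 1)) :
    remainder n s f = ∫ θ in (0 : ℝ)..Real.pi,
      (f (Real.cos θ) - (hermiteInterpolant n s f).eval ((Real.cos θ : ℝ) : ℂ)) *
        (Chebyshev.T ℂ n).eval ((Real.cos θ : ℝ) : ℂ) := by
  rw [remainder, sum_weight_mul_iteratedDeriv, ← intervalIntegral.integral_sub
    (intervalIntegrable_mul_T_div_sqrt n hf) (intervalIntegrable_mul_T_div_sqrt n (by fun_prop)),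
    ← integral_mul_inv_sqrt_eq_integral_cos fun t : ℝ =>
      (f t - (hermiteInterpolant n s f).eval (t : ℂ)) * (Chebyshev.T ℂ n).eval (t : ℂ)]
  refine intervalIntegral.integral_congr fun t _ => ?_
  simp only [← Chebyshev.complex_ofReal_eval_T]
  push_cast
  ring

/-! ### Folding onto the unit circle -/

theorem circleIntegral_inv_mul (h : ℂ → ℂ) {r : ℝ} (hr : r ≠ 0) :
    (∮ u in C(0, r), u⁻¹ * h u) = Complex.I * ∫ θ in (0 : ℝ)..2 * Real.pi, h (circleMap 0 r θ) := by
  rw [circleIntegral, ← intervalIntegral.integral_const_mul]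
  refine intervalIntegral.integral_congr fun θ _ => ?_
  have := circleMap_ne_center (c := 0) (θ := θ) hr
  simp only [deriv_circleMap, smul_eq_mul]
  field_simp

theorem integral_add_reflect_eq (h : ℝ → ℂ) (hh : Continuous h) :
    ∫ θ in (0 : ℝ)..Real.pi, (h θ + h (2 * Real.pi - θ)) = ∫ θ in (0 : ℝ)..2 * Real.pi, h θ := by
  have hh' : Continuous fun θ => h (2 * Real.pi - θ) := by fun_prop
  rw [intervalIntegral.integral_add (hh.intervalIntegrable _ _) (hh'.intervalIntegrable _ _),
    intervalIntegral.integral_comp_sub_left (fun θ => h θ),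
    show 2 * Real.pi - Real.pi = Real.pi by ring, sub_zero,
    intervalIntegral.integral_add_adjacent_intervals (hh.intervalIntegrable _ _)
      (hh.intervalIntegrable _ _)]

theorem eval_T_joukowski_pow (n s : ℕ) {u : ℂ} (hu : u ≠ 0) :
    (Chebyshev.T ℂ n).eval (joukowski u) ^ (2 * s + 1) =
      (2 ^ (2 * s + 1))⁻¹ * (halfBinomial s (u ^ (2 * n)) / u ^ (n * (2 * s + 1)) +
        halfBinomial s (u⁻¹ ^ (2 * n)) / u⁻¹ ^ (n * (2 * s + 1))) := by
  rw [eval_T_joukowski n hu, div_pow, ← halfBinomial_add_reverse s (pow_ne_zero _ hu), inv_pow,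
    inv_pow, ← pow_mul, mul_pow, ← pow_mul,
    show 2 * n * (2 * s + 1) = n * (2 * s + 1) + n * (2 * s + 1) by ring, pow_add]
  have := pow_ne_zero (n * (2 * s + 1)) hu
  field_simp

/-- J(u) = J(1/u), so g takes the same value at θ and 2π - θ, while the two halves of T_n^(2s+1)
trade places. The integral is written with g because `remainderKernel` has poles on the unit circle,
above the nodes, once s ≥ 1. -/
theorem remainder_eq_circleIntegral_one {n s : ℕ} {ρ : ℝ} (hρ : 1 < ρ) {f g : ℂ → ℂ}
    (hf : AnalyticOnNhd ℂ f (ellipseInterior ρ)) (hg : AnalyticOnNhd ℂ g (ellipseInterior ρ))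
    (hfg : ∀ z ∈ ellipseInterior ρ,
      f z - (hermiteInterpolant n s f).eval z = ((Chebyshev.T ℂ n).eval z) ^ (2 * s) * g z) :
    remainder n s f = (2 ^ (2 * s + 1) * Complex.I)⁻¹ *
      ∮ u in C(0, 1), u⁻¹ *
        (halfBinomial s (u ^ (2 * n)) / u ^ (n * (2 * s + 1)) * g (joukowski u)) := by
  have hcos : ∀ θ : ℝ, ((Real.cos θ : ℝ) : ℂ) ∈ ellipseInterior ρ := fun θ =>
    ofReal_mem_ellipseInterior hρ (Real.cos_mem_Icc θ)
  have hu : ∀ θ : ℝ, circleMap 0 1 θ ≠ 0 := fun θ => circleMap_ne_center one_ne_zero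
  have hJ : ∀ θ : ℝ, joukowski (circleMap 0 1 θ) = ((Real.cos θ : ℝ) : ℂ) := fun θ => by
    simp [circleMap, joukowski_exp]
  set h : ℝ → ℂ := fun θ => halfBinomial s (circleMap 0 1 θ ^ (2 * n)) /
    circleMap 0 1 θ ^ (n * (2 * s + 1)) * g (joukowski (circleMap 0 1 θ)) with hh
  have hcont : Continuous h := by
    refine Continuous.mul (Continuous.div ?_ (by fun_prop) fun θ => pow_ne_zero _ (hu θ)) ?_
    · simp only [halfBinomial]
      fun_prop
    · simp only [hJ]
      exact continuous_iff_continuousAt.mpr fun θ => ContinuousAt.comp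
        (f := fun θ : ℝ => ((Real.cos θ : ℝ) : ℂ)) (hg _ (hcos θ)).continuousAt (by fun_prop)
  rw [circleIntegral_inv_mul _ one_ne_zero, ← integral_add_reflect_eq h hcont,
    remainder_eq_integral_cos n s (f := f) (fun t ht => ContinuousAt.continuousWithinAt <|
      ContinuousAt.comp (f := fun t : ℝ => (t : ℂ))
        (hf _ (ofReal_mem_ellipseInterior hρ ht)).continuousAt (by fun_prop)),
    mul_inv, mul_assoc, inv_mul_cancel_left₀ Complex.I_ne_zero,
    ← intervalIntegral.integral_const_mul]
  refine intervalIntegral.integral_congr fun θ _ => ?_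
  have hrefl : circleMap 0 1 (2 * Real.pi - θ) = (circleMap 0 1 θ)⁻¹ := by
    simp [circleMap, ← Complex.exp_neg, sub_mul, Complex.exp_sub, Complex.exp_two_pi_mul_I]
  have hJ' : joukowski (circleMap 0 1 θ)⁻¹ = joukowski (circleMap 0 1 θ) := by
    rw [joukowski, joukowski, inv_inv, add_comm]
  simp only [hh, hrefl, hJ']
  rw [hfg _ (hcos θ), ← add_mul, ← mul_assoc, ← eval_T_joukowski_pow n s (hu θ), hJ]
  ring

/-! ### The kernel and the outward deformation of the contour -/

/-- The kernel `halfBinomial s (u^(2n)) / (u^n (1 + u^(2n))^(2s))` of the remainder in the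
coordinate `u` of the Joukowski map. -/
noncomputable def remainderKernel (n s : ℕ) (u : ℂ) : ℂ :=
  halfBinomial s (u ^ (2 * n)) / (1 + u ^ (2 * n)) ^ (2 * s) / u ^ n

theorem one_add_pow_ne_zero {n : ℕ} (hn : 1 ≤ n) {u : ℂ} (hu : 1 < ‖u‖) :
    1 + u ^ (2 * n) ≠ 0 := by
  intro h
  have h1 : u ^ (2 * n) = -1 := by linear_combination h
  have h2 := congrArg norm h1
  rw [norm_pow, norm_neg, norm_one] at h2
  exact (one_lt_pow₀ hu (by omega)).ne' h2

theorem differentiableAt_remainderKernel {n : ℕ} (hn : 1 ≤ n) (s : ℕ) {u : ℂ} (hu : 1 < ‖u‖) :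
    DifferentiableAt ℂ (remainderKernel n s) u := by
  have hu0 : u ≠ 0 := norm_pos_iff.mp (by linarith)
  unfold remainderKernel
  refine DifferentiableAt.div (DifferentiableAt.div ?_ (by fun_prop)
    (pow_ne_zero _ (one_add_pow_ne_zero hn hu))) (by fun_prop) (pow_ne_zero _ hu0)
  simp only [halfBinomial]
  fun_prop

theorem halfBinomial_div_eq {n : ℕ} (hn : 1 ≤ n) (s : ℕ) {u : ℂ} (hu : 1 < ‖u‖) :
    halfBinomial s (u ^ (2 * n)) / u ^ (n * (2 * s + 1)) =
      2 ^ (2 * s) * remainderKernel n s u *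
        (Chebyshev.T ℂ n).eval (joukowski u) ^ (2 * s) := by
  have hu0 : u ≠ 0 := norm_pos_iff.mp (by linarith)
  rw [remainderKernel, eval_T_joukowski n hu0, div_pow, mul_pow, ← pow_mul, mul_add, pow_add,
    mul_one]
  have h1 := pow_ne_zero (2 * s) (one_add_pow_ne_zero hn hu)
  have h2 := pow_ne_zero n hu0
  have h3 := pow_ne_zero (n * (2 * s)) hu0
  field_simp

/-- Cauchy's theorem on an annulus. Continuity relative to the closed annulus suffices at its
boundary, which is all that f offers on |u| = ρ. -/
theorem circleIntegral_inv_mul_eq_of_annulus {r R : ℝ} (hr : 0 < r) (hrR : r ≤ R) {h : ℂ → ℂ}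
    (hc : ∀ u, r ≤ ‖u‖ → ‖u‖ ≤ R → ContinuousWithinAt h {u | ‖u‖ ≤ R ∧ r ≤ ‖u‖} u)
    (hd : ∀ u, r < ‖u‖ → ‖u‖ < R → DifferentiableAt ℂ h u) :
    (∮ u in C(0, R), u⁻¹ * h u) = ∮ u in C(0, r), u⁻¹ * h u := by
  have hset : Metric.closedBall (0 : ℂ) R \ Metric.ball 0 r = {u | ‖u‖ ≤ R ∧ r ≤ ‖u‖} := by
    ext u
    simp
  have := Complex.circleIntegral_sub_center_inv_smul_eq_of_differentiable_on_annulus_off_countable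
    (c := 0) hr hrR (f := h) Set.countable_empty (by
      rw [hset]
      exact fun u hu => hc u hu.2 hu.1) (fun u hu => by
      simp only [Set.mem_sdiff, Metric.mem_ball, Metric.mem_closedBall, dist_zero_right,
        not_le] at hu
      exact hd u hu.1.2 hu.1.1)
  simpa using this

/-- If `h` is holomorphic for `‖u‖ > 1` and tends to `0` at infinity, then `∮ h(u) du/u = 0`. -/
theorem circleIntegral_inv_mul_eq_zero_of_tendsto {h : ℂ → ℂ}
    (hd : ∀ u, 1 < ‖u‖ → DifferentiableAt ℂ h u) (h0 : Tendsto h (Bornology.cobounded ℂ) (𝓝 0))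
    {r : ℝ} (hr : 1 < r) : (∮ u in C(0, r), u⁻¹ * h u) = 0 := by
  have hr0 : 0 < r := by linarith
  rw [← norm_eq_zero]
  refine le_antisymm (le_of_forall_pos_le_add fun ε hε => ?_) (norm_nonneg _)
  rw [zero_add]
  have hpi := Real.pi_pos
  have hev : ∀ᶠ u in Bornology.cobounded ℂ, ‖h u‖ ≤ ε / (2 * Real.pi) := by
    have := h0.norm
    rw [norm_zero] at this
    exact this.eventually_le_const (by positivity)
  rw [← comap_norm_atTop, eventually_comap] at hev
  -- The integral is the same on every larger circle, and the length 2πR cancels the factor 1/R,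
  -- leaving the bound ε.
  obtain ⟨R, hR, hrR⟩ := (hev.and (eventually_ge_atTop r)).exists
  have hR0 : 0 < R := hr0.trans_le hrR
  rw [← circleIntegral_inv_mul_eq_of_annulus hr0 hrR
    (fun u hu _ => (hd u (hr.trans_le hu)).continuousAt.continuousWithinAt)
    (fun u hu _ => hd u (hr.trans hu))]
  refine (circleIntegral.norm_integral_le_of_norm_le_const (C := R⁻¹ * (ε / (2 * Real.pi)))
    hR0.le fun u hu => ?_).trans (le_of_eq ?_)
  · have hu' : ‖u‖ = R := by simpa using hu
    rw [norm_mul, norm_inv, hu']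
    gcongr
    exact hR u hu'
  · field_simp

theorem tendsto_remainderKernel_mul_eval {n : ℕ} (hn : 1 ≤ n) (s : ℕ) {p : ℂ[X]}
    (hp : p.degree < ((n * (2 * s) : ℕ) : WithBot ℕ)) :
    Tendsto (fun u => remainderKernel n s u * p.eval (joukowski u)) (Bornology.cobounded ℂ)
      (𝓝 0) := by
  -- The same function in w = 1/u. The kernel is of order u^(-2ns-n) and p(J(u)) is O(u^(2ns-1));
  -- clearing powers of u leaves an expression continuous at w = 0, and its factor w^n makes it
  -- vanish there.
  set Φ : ℂ → ℂ := fun w =>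
    (∑ j ∈ Finset.range (s + 1), (Nat.choose (2 * s + 1) j : ℂ) * w ^ (2 * n * (s - j))) *
      (∑ k ∈ Finset.range (n * (2 * s)),
        p.coeff k * (((1 + w ^ 2) / 2) ^ k * w ^ (n * (2 * s) - k))) *
      w ^ n / (1 + w ^ (2 * n)) ^ (2 * s) with hΦ
  have hΦ0 : Tendsto Φ (𝓝 0) (𝓝 0) := by
    have hc : ContinuousAt Φ 0 := by
      refine ContinuousAt.div (by fun_prop) (by fun_prop) (pow_ne_zero _ ?_)
      rw [zero_pow (by omega)]
      simp
    have h0 : Φ 0 = 0 := by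
      simp only [hΦ]
      rw [zero_pow (show n ≠ 0 by omega)]
      simp
    simpa only [h0] using hc.tendsto
  refine (hΦ0.comp (tendsto_inv₀_cobounded (α := ℂ))).congr' ?_
  have hev : ∀ᶠ u : ℂ in Bornology.cobounded ℂ, 1 < ‖u‖ := by
    rw [← comap_norm_atTop]
    exact (eventually_gt_atTop 1).comap _
  filter_upwards [hev] with u hu
  have hu0 : u ≠ 0 := norm_pos_iff.mp (by linarith)
  have hden := pow_ne_zero (2 * s) (one_add_pow_ne_zero hn hu)
  have h1 : ∑ j ∈ Finset.range (s + 1), (Nat.choose (2 * s + 1) j : ℂ) * u⁻¹ ^ (2 * n * (s - j)) =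
      halfBinomial s (u ^ (2 * n)) / u ^ (2 * n * s) := by
    rw [halfBinomial, Finset.sum_div]
    refine Finset.sum_congr rfl fun j hj => ?_
    have hj' : j ≤ s := by simpa [Nat.lt_succ_iff] using hj
    obtain ⟨k, rfl⟩ := Nat.exists_eq_add_of_le hj'
    rw [show j + k - j = k by omega, mul_add (2 * n), pow_add, ← pow_mul, inv_pow]
    have := pow_ne_zero (2 * n * j) hu0
    have := pow_ne_zero (2 * n * k) hu0
    field_simp
  have h2 : ∑ k ∈ Finset.range (n * (2 * s)),
      p.coeff k * (((1 + u⁻¹ ^ 2) / 2) ^ k * u⁻¹ ^ (n * (2 * s) - k)) =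
      p.eval (joukowski u) / u ^ (2 * n * s) := by
    have hpe : p.eval (joukowski u) =
        ∑ k ∈ Finset.range (n * (2 * s)), p.coeff k * joukowski u ^ k := by
      rcases eq_or_ne p 0 with rfl | hp0
      · simp
      · exact eval_eq_sum_range' ((natDegree_lt_iff_degree_lt hp0).mpr hp) _
    rw [hpe, Finset.sum_div]
    refine Finset.sum_congr rfl fun k hk => ?_
    have hJ : joukowski u = (1 + u⁻¹ ^ 2) / 2 * u := by
      rw [joukowski]
      field_simp
    obtain ⟨l, hl⟩ := Nat.exists_eq_add_of_le (Finset.mem_range.mp hk).le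
    rw [hJ, show 2 * n * s = n * (2 * s) by ring, hl, show k + l - k = l by omega, pow_add,
      mul_pow, inv_pow _ l]
    have := pow_ne_zero k hu0
    have := pow_ne_zero l hu0
    field_simp
  have h3 : (1 + u⁻¹ ^ (2 * n)) ^ (2 * s) =
      (1 + u ^ (2 * n)) ^ (2 * s) / (u ^ (2 * n * s) * u ^ (2 * n * s)) := by
    rw [← pow_add, show 2 * n * s + 2 * n * s = 2 * n * (2 * s) by ring, pow_mul u (2 * n),
      ← div_pow, inv_pow]
    have := pow_ne_zero (2 * n) hu0
    congr 1
    field_simp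
    ring
  simp only [hΦ, Function.comp_apply]
  rw [h1, h2, h3, remainderKernel, inv_pow]
  have := pow_ne_zero (2 * n * s) hu0
  have := pow_ne_zero n hu0
  field_simp

theorem remainder_eq_circleIntegral {n s : ℕ} (hn : 1 ≤ n) {ρ : ℝ} (hρ : 1 < ρ) {f : ℂ → ℂ}
    (hf : AnalyticOnNhd ℂ f (ellipseInterior ρ))
    (hfc : ContinuousOn f (closure (ellipseInterior ρ))) :
    remainder n s f = (2 * Complex.I)⁻¹ *
      ∮ u in C(0, ρ), u⁻¹ * (remainderKernel n s u * f (joukowski u)) := by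
  obtain ⟨g, hg, hfg⟩ := exists_sub_hermiteInterpolant_eq (n := n) (s := s) hρ hf
  set p := hermiteInterpolant n s f with hp
  -- The intermediate circle avoids both the poles of the kernel on |u| = 1 and the boundary |u| =
  -- ρ, where g is not controlled.
  obtain ⟨r, hr1, hrρ⟩ := exists_between hρ
  have hr0 : 0 < r := by linarith
  have hne : ∀ {u : ℂ}, 1 ≤ ‖u‖ → u ≠ 0 := fun h => norm_pos_iff.mp (by linarith)
  have hcomp : ∀ {k : ℂ → ℂ}, AnalyticOnNhd ℂ k (ellipseInterior ρ) → ∀ u, 1 ≤ ‖u‖ → ‖u‖ < ρ →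
      DifferentiableAt ℂ (fun u => k (joukowski u)) u := fun {k} hk u h1 h2 =>
    DifferentiableAt.comp u (hk _ (joukowski_mem_ellipseInterior h1 h2)).differentiableAt
      (differentiableAt_joukowski (hne h1))
  have hdiff1 : ∀ u : ℂ, 1 ≤ ‖u‖ → ‖u‖ < ρ → DifferentiableAt ℂ
      (fun u => halfBinomial s (u ^ (2 * n)) / u ^ (n * (2 * s + 1)) * g (joukowski u)) u := by
    intro u h1 h2
    refine DifferentiableAt.mul (DifferentiableAt.div ?_ (by fun_prop) (pow_ne_zero _ (hne h1)))
      (hcomp hg u h1 h2)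
    simp only [halfBinomial]
    fun_prop
  have hdiff2 : ∀ u : ℂ, 1 < ‖u‖ → ‖u‖ < ρ →
      DifferentiableAt ℂ (fun u => remainderKernel n s u * f (joukowski u)) u := fun u h1 h2 =>
    (differentiableAt_remainderKernel hn s h1).mul (hcomp hf u h1.le h2)
  have hdiff3 : ∀ u : ℂ, 1 < ‖u‖ →
      DifferentiableAt ℂ (fun u => remainderKernel n s u * p.eval (joukowski u)) u := fun u h1 =>
    (differentiableAt_remainderKernel hn s h1).mul
      (DifferentiableAt.comp u p.differentiableAt (differentiableAt_joukowski (hne h1.le)))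
  have hsphere : ∀ {u : ℂ}, u ∈ Metric.sphere (0 : ℂ) r → ‖u‖ = r := fun h => by simpa using h
  rw [remainder_eq_circleIntegral_one hρ hf hg hfg,
    ← circleIntegral_inv_mul_eq_of_annulus zero_lt_one hr1.le
      (fun u h1 h2 => (hdiff1 u h1 (h2.trans_lt hrρ)).continuousAt.continuousWithinAt)
      (fun u h1 h2 => hdiff1 u h1.le (h2.trans hrρ)),
    circleIntegral_inv_mul_eq_of_annulus (h := fun u => remainderKernel n s u * f (joukowski u))
      hr0 hrρ.le (fun u h1 h2 => ?_) (fun u h1 h2 => hdiff2 u (hr1.trans h1) h2)]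
  · have hci : ∀ {k : ℂ → ℂ}, (∀ u, ‖u‖ = r → ContinuousAt k u) →
        CircleIntegrable (fun u => u⁻¹ * k u) 0 r := fun {k} hk =>
      ContinuousOn.circleIntegrable hr0.le fun u hu => ContinuousAt.continuousWithinAt <|
        (continuousAt_inv₀ (hne (by rw [hsphere hu]; exact hr1.le))).mul (hk u (hsphere hu))
    have hzero := circleIntegral_inv_mul_eq_zero_of_tendsto hdiff3
      (tendsto_remainderKernel_mul_eval hn s (degree_hermiteInterpolant_lt n s f)) hr1
    have hsplit := circleIntegral.integral_sub
      (hci fun u hu => (hdiff2 u (by rwa [hu]) (by rwa [hu])).continuousAt)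
      (hci fun u hu => (hdiff3 u (by rwa [hu])).continuousAt)
    rw [hzero, sub_zero] at hsplit
    rw [← hsplit]
    -- Here g T_n^(2s) is turned back into f - p, so that g disappears.
    have hcongr : (∮ u in C(0, r), u⁻¹ *
        (halfBinomial s (u ^ (2 * n)) / u ^ (n * (2 * s + 1)) * g (joukowski u))) =
        ∮ u in C(0, r), (2 : ℂ) ^ (2 * s) * (u⁻¹ * (remainderKernel n s u * f (joukowski u)) -
          u⁻¹ * (remainderKernel n s u * p.eval (joukowski u))) := by
      refine circleIntegral.integral_congr hr0.le fun u hu => ?_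
      have hu1 : 1 < ‖u‖ := by rwa [hsphere hu]
      have hmem := joukowski_mem_ellipseInterior hu1.le (by rwa [hsphere hu])
      rw [halfBinomial_div_eq hn s hu1]
      linear_combination (-(2 : ℂ) ^ (2 * s) * u⁻¹ * remainderKernel n s u) * hfg _ hmem
    rw [hcongr, circleIntegral.integral_const_mul, ← mul_assoc]
    congr 1
    have := pow_ne_zero (2 * s) (two_ne_zero (α := ℂ))
    have := Complex.I_ne_zero
    rw [pow_succ]
    field_simp
  · have hu1 : 1 < ‖u‖ := hr1.trans_le h1
    refine (differentiableAt_remainderKernel hn s hu1).continuousAt.continuousWithinAt.mul ?_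
    exact ContinuousWithinAt.comp (t := closure (ellipseInterior ρ))
      (hfc _ (joukowski_mem_closure hρ hu1.le h2))
      (continuousAt_joukowski (hne hu1.le)).continuousWithinAt
      fun v hv => joukowski_mem_closure hρ (hr1.le.trans hv.2) hv.1

/-! ### The estimate -/

theorem norm_remainderKernel_le {n : ℕ} (hn : 1 ≤ n) (s : ℕ) {ρ : ℝ} (hρ : 1 < ρ) {u : ℂ}
    (hu : ‖u‖ = ρ) :
    ‖remainderKernel n s u‖ ≤
      (∑ k ∈ Finset.range (s + 1),
        (-1 : ℝ) ^ k * (Nat.choose (2 * s + 1) (s - k) : ℝ) * ρ ^ (2 * n * (s - k))) /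
        (ρ ^ n * (ρ ^ (2 * n) - 1) ^ (2 * s)) := by
  have h := norm_halfBinomial_div_le s (q := ρ ^ (2 * n)) (x := u ^ (2 * n))
    (one_lt_pow₀ hρ (by omega)) (by rw [norm_pow, hu])
  simp only [← pow_mul] at h
  rw [remainderKernel, norm_div, norm_pow u n, hu, mul_comm (ρ ^ n), ← div_div]
  gcongr

end FourierChebyshev

theorem theorem3 (n s : ℕ) (hn : 1 ≤ n) (hs : 1 ≤ s) (ρ : ℝ) (hρ : 1 < ρ) (f : ℂ → ℂ)
    (hf : AnalyticOnNhd ℂ f (FourierChebyshev.ellipseInterior ρ))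
    (hfc : ContinuousOn f (closure (FourierChebyshev.ellipseInterior ρ))) :
    ∃ M : ℝ, IsGreatest ((fun z : ℂ => ‖f z‖) '' FourierChebyshev.ellipse ρ) M ∧
      ‖FourierChebyshev.remainder n s f‖ ≤
        2 * Real.pi * M *
          ((∑ k ∈ Finset.range (s + 1),
              (-1 : ℝ) ^ k * (Nat.choose (2 * s + 1) (s - k) : ℝ) * ρ ^ (2 * n * (s - k))) /
            (ρ ^ n * (ρ ^ (2 * n) - 1) ^ (2 * s))) := by
  have hρ0 : 0 < ρ := by linarith
  obtain ⟨M, hM⟩ := ((FourierChebyshev.isCompact_ellipse hρ0).image_of_continuousOn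
    (hfc.mono (FourierChebyshev.ellipse_subset_closure hρ)).norm).exists_isGreatest
    ((FourierChebyshev.ellipse_nonempty ρ).image _)
  refine ⟨M, hM, ?_⟩
  set B := (∑ k ∈ Finset.range (s + 1),
      (-1 : ℝ) ^ k * (Nat.choose (2 * s + 1) (s - k) : ℝ) * ρ ^ (2 * n * (s - k))) /
    (ρ ^ n * (ρ ^ (2 * n) - 1) ^ (2 * s)) with hB
  have hkernel : ∀ u : ℂ, ‖u‖ = ρ → ‖FourierChebyshev.remainderKernel n s u‖ ≤ B := fun u hu =>
    FourierChebyshev.norm_remainderKernel_le hn s hρ hu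
  -- The sign of the alternating sum is not apparent; it is read off from B being an upper bound for
  -- a norm.
  have hB0 : 0 ≤ B := (norm_nonneg _).trans
    (hkernel ρ (by rw [Complex.norm_real, Real.norm_of_nonneg hρ0.le]))
  have hM0 : 0 ≤ M := by
    obtain ⟨z, -, rfl⟩ := hM.1
    exact norm_nonneg _
  have hI : ‖∮ u in C(0, ρ), u⁻¹ *
      (FourierChebyshev.remainderKernel n s u * f (FourierChebyshev.joukowski u))‖ ≤
      2 * Real.pi * ρ * (ρ⁻¹ * (B * M)) := by
    refine circleIntegral.norm_integral_le_of_norm_le_const hρ0.le fun u hu => ?_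
    have hu' : ‖u‖ = ρ := by simpa using hu
    rw [norm_mul, norm_mul, norm_inv, hu']
    have h1 := hkernel u hu'
    have h2 : ‖f (FourierChebyshev.joukowski u)‖ ≤ M :=
      hM.2 ⟨_, FourierChebyshev.joukowski_mem_ellipse hu', rfl⟩
    gcongr
  have h2I : ‖(2 * Complex.I)⁻¹‖ = 1 / 2 := by simp
  have hcancel : 2 * Real.pi * ρ * (ρ⁻¹ * (B * M)) = 2 * Real.pi * M * B := by
    field_simp
  have hnonneg : 0 ≤ 2 * Real.pi * M * B := by positivity
  rw [FourierChebyshev.remainder_eq_circleIntegral hn hρ hf hfc, norm_mul, h2I]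
  rw [hcancel] at hI
  -- The prefactor 1/(2i) gives the stronger bound π M B, which is half of what is claimed.
  linarith
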